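/- Let $N\ge 2$ and $p>N$ be integers with $\gcd(p,N+1)=1$. Modular invariants. Given a finite set $\Phi$ with a distinguished element $0$ (the vacuum) and matrices $S,T\in\mathbb{C}^{\Phi\times\Phi}$, a modular invariant of $(\Phi,0,S,T)$ is a matrix $M$ indexed by $\Phi$ with entries in $\mathbb{Z}_{\ge0}$ such that $M_{00}=1$, $SM=MS$ and $TM=MT$. SU$(N)$ at height $n\ge N$ (that is, at level $n-N$). The primaries are $$\Phi_N^n=\{\lambda=(\lambda_1,\dots,\lambda_{N-1})\in\mathbb{Z}^{N-1}:\lambda_i>0,\ \lambda_1+\dots+\lambda_{N-1}<n\},$$ with vacuum $\rho=(1,\dots,1)$. Put $t(\lambda)=\sum_{j=1}^{N-1}j\lambda_j$, $\lambda[i]=\sum_{i\le l<N}\lambda_l$ for $1\le i\le N$ (so $\lambda[N]=0$), and let $$\lambda\cdot\mu=\sum_{1\le i<N}\tfrac{i(N-i)}{N}\lambda_i\mu_i+\sum_{1\le i<j<N}\tfrac{i(N-j)}{N}(\lambda_i\mu_j+\lambda_j\mu_i),\qquad \lambda^2=\lambda\cdot\lambda .$$ For a rational number $n>0$ let $$D^{(n)}_{\lambda\mu}=\exp\!\Big[\tfrac{2\pi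 i\,t(\lambda)t(\mu)}{Nn}\Big]\det\Big(\exp\!\big[-2\pi i\,\lambda[a]\mu[b]/n\big]\Big)_{1\le a,b\le N}.$$ The modular data of SU$(N)$ at integer height $n$ is $S_{\lambda\mu}=\beta D^{(n)}_{\lambda\mu}$ and $T_{\lambda\mu}=\delta_{\lambda\mu}\,\alpha\exp[\pi i\lambda^2/n]$, with $\beta=i^{N(N-1)/2}/\sqrt{N n^{N-1}}$ and $\alpha=e^{-\pi i(N^2-1)/12}$. $W_N(p,q)$, for coprime $p,q>N$. Let $J(\lambda_1,\dots,\lambda_{N-1})=(\lambda_0,\lambda_1,\dots,\lambda_{N-2})$ on $\Phi_N^p$, where $\lambda_0=p-\lambda_1-\dots-\lambda_{N-1}$, and let $K$ be the corresponding permutation of $\Phi_N^q$. The primaries are the orbits $[\lambda\mu]$ of pairs $(\lambda,\mu)\in\Phi_N^p\times\Phi_N^q$ under the cyclic group generated by $JK:(\lambda,\mu)\mapsto(J\lambda,K\mu)$; the vacuum is $[\rho\rho]$. The modular data, which is well defined on orbits, is $$S_{[\lambda\mu][\kappa\nu]}=\alpha'\exp\!\Big[-2\pi i\,\tfrac{t(\lambda)t(\nu)+t(\mu)t(\kappa)}{N}\Big]D^{(p/q)}_{\lambda\kappa}D^{(q/p)}_{\mu\nu},\qquad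 T_{[\lambda\mu][\lambda\mu]}=\beta'\exp\!\Big[\tfrac{\pi i\,(q\lambda-p\mu)^2}{pq}\Big],$$ with $T$ diagonal, $\alpha'=1/\sqrt{N(pq)^{N-1}}$ and $\beta'=e^{-\pi i(N-1)/12}$. Corollary. The map $M\mapsto M'$, where $$M'_{\lambda\kappa}=M_{[\lambda\rho][\kappa\rho]}\qquad(\lambda,\kappa\in\Phi_N^p),$$ is a bijection from the set of modular invariants of $W_N(p,N+1)$ onto the set of modular invariants of SU$(N)$ at height $p$, i.e. at level $p-N$. -/

import Mathlib

noncomputable section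

namespace WNModel

open Complex

/-! ### Modular invariants of arbitrary modular data -/

/-- `M` is a modular invariant for the modular data `S`, `T` with vacuum `o`: its entries are
nonnegative integers, `M o o = 1`, and `M` commutes with `S` and with `T`. -/
def IsModularInvariant {Φ : Type*} [Fintype Φ] (S T : Matrix Φ Φ ℂ) (o : Φ)
    (M : Matrix Φ Φ ℕ) : Prop :=
  M o o = 1 ∧
    S * M.map (Nat.cast : ℕ → ℂ) = M.map (Nat.cast : ℕ → ℂ) * S ∧
    T * M.map (Nat.cast : ℕ → ℂ) = M.map (Nat.cast : ℕ → ℂ) * T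

/-! ### The primaries of `SU(N)` at height `n`

A weight `(x₁, …, x_{N-1})` with `0 < xᵢ` and `x₁ + ⋯ + x_{N-1} < n` is stored together with its
extended Dynkin label `x₀ = n - x₁ - ⋯ - x_{N-1}`, which it determines. The weights are shifted
by the Weyl vector, and the height is `n = level + N`. -/

/-- The primaries of `SU(N)` at height `n`, by their extended Dynkin labels `x₀, …, x_{N-1}`. -/
@[ext]
structure Weight (N n : ℕ) : Type where
  /-- the extended Dynkin labels -/
  val : Fin N → ℤ
  pos : ∀ i, 0 < val i
  sum_eq : ∑ i, val i = (n : ℤ)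

instance (N n : ℕ) : Finite (Weight N n) := by
  have hle : ∀ (x : Weight N n) (i : Fin N), x.1 i ≤ n := fun x i => by
    have h := Finset.single_le_sum (f := x.1) (fun j _ => (x.pos j).le) (Finset.mem_univ i)
    rwa [x.sum_eq] at h
  refine Finite.of_injective
    (fun (x : Weight N n) (i : Fin N) =>
      (⟨x.1 i, (x.pos i).le, hle x i⟩ : Set.Icc (0 : ℤ) (n : ℤ))) ?_
  intro x y h
  ext i
  exact congrArg Subtype.val (congrFun h i)

instance (N n : ℕ) : Fintype (Weight N n) := Fintype.ofFinite _

/-- The vacuum of `SU(N)` at height `n`: the Weyl vector `ρ = (1, …, 1)`, for which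
`x₀ = n - (N - 1)`. -/
def rho {N n : ℕ} (hN : 0 < N) (h : N ≤ n) : Weight N n :=
  ⟨fun i => if (i : ℕ) = 0 then (n : ℤ) - N + 1 else 1, by
    intro i
    split_ifs <;> omega, by
    obtain ⟨m, rfl⟩ : ∃ m, N = m + 1 := ⟨N - 1, by omega⟩
    rw [Fin.sum_univ_succ]
    simp
    ring⟩

/-- The simple-current `J (x₁, …, x_{N-1}) = (x₀, x₁, …, x_{N-2})`: the cyclic shift of the
extended Dynkin labels. -/
def simpleCurrent (N n : ℕ) : Equiv.Perm (Weight N n) where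
  toFun x := ⟨x.1 ∘ (finRotate N).symm, fun _ => x.pos _,
    (Equiv.sum_comp (finRotate N).symm x.1).trans x.sum_eq⟩
  invFun x := ⟨x.1 ∘ finRotate N, fun _ => x.pos _,
    (Equiv.sum_comp (finRotate N) x.1).trans x.sum_eq⟩
  left_inv x := Weight.ext (funext fun i => congrArg x.1 ((finRotate N).symm_apply_apply i))
  right_inv x := Weight.ext (funext fun i => congrArg x.1 ((finRotate N).apply_symm_apply i))

instance (N n : ℕ) : DecidableEq (Weight N n) := Classical.decEq _

/-! ### The modular data of `SU(N)` at height `n` -/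

/-- `N`-ality: `t(x) = ∑_{j=1}^{N-1} j xⱼ`. -/
def ality {N : ℕ} (x : Fin N → ℤ) : ℤ := ∑ j : Fin N, (j : ℤ) * x j

/-- The partial sums `x[i] = ∑_{i ≤ l < N} x_l`, `1 ≤ i ≤ N`; the index `i : Fin N` here
stands for `x[i + 1]`. -/
def bracket {N : ℕ} (x : Fin N → ℤ) (i : Fin N) : ℤ := ∑ l ∈ Finset.Ioi i, x l

/-- The inner product of weights,
`x · y = ∑_{i} i(N-i)/N xᵢ yᵢ + ∑_{i<j} i(N-j)/N (xᵢ yⱼ + xⱼ yᵢ)`, with `1 ≤ i, j < N`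
(the label with index `0` has coefficient `0`). -/
def dot {N : ℕ} (x y : Fin N → ℤ) : ℚ :=
  ∑ i : Fin N, ∑ j : Fin N,
    ((min (i : ℕ) (j : ℕ) : ℕ) : ℚ) * ((N : ℚ) - ((max (i : ℕ) (j : ℕ) : ℕ) : ℚ)) / (N : ℚ)
      * x i * y j

/-- The unnormalised `S`-matrix of `SU(N)` at a height `n` that may be fractional:
`exp(2πi t(x) t(y) / (N n)) · det (exp(-2πi x[i] y[j] / n))`. -/
def kacPeterson (N : ℕ) (n : ℚ) (x y : Fin N → ℤ) : ℂ :=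
  exp (2 * Real.pi * I * ality x * ality y / (N * n)) *
    (Matrix.of fun i j : Fin N =>
      exp (-(2 * Real.pi * I * bracket x i * bracket y j / n))).det

/-- The `S`-matrix of `SU(N)` at height `n`. -/
def suS (N n : ℕ) : Matrix (Weight N n) (Weight N n) ℂ :=
  Matrix.of fun x y =>
    I ^ (N * (N - 1) / 2) / ((Real.sqrt (N * (n : ℝ) ^ (N - 1)) : ℝ) : ℂ) *
      kacPeterson N n x.1 y.1

/-- The diagonal `T`-matrix of `SU(N)` at height `n`, with entries
`exp(-πi (N² - 1) / 12) exp(πi x² / n)`. -/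
def suT (N n : ℕ) : Matrix (Weight N n) (Weight N n) ℂ :=
  Matrix.diagonal fun x =>
    exp (-(Real.pi * I * ((N : ℂ) ^ 2 - 1) / 12)) * exp (Real.pi * I * dot x.1 x.1 / n)

/-! ### The primaries of the minimal model `W_N(p, q)` -/

/-- The permutation `JK` of the pairs of weights: `(x, y) ↦ (J x, K y)`. -/
def simpleCurrentPair (N p q : ℕ) : Equiv.Perm (Weight N p × Weight N q) :=
  Equiv.prodCongr (simpleCurrent N p) (simpleCurrent N q)

/-- Two pairs are related when they lie in one `⟨JK⟩`-orbit. -/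
def orbitSetoid (N p q : ℕ) : Setoid (Weight N p × Weight N q) :=
  Equiv.Perm.SameCycle.setoid (simpleCurrentPair N p q)

/-- The primaries of `W_N(p, q)`: the `⟨JK⟩`-orbits of pairs of weights. -/
def WPrimary (N p q : ℕ) : Type := Quotient (orbitSetoid N p q)

instance (N p q : ℕ) : Finite (WPrimary N p q) :=
  inferInstanceAs (Finite (Quotient (orbitSetoid N p q)))

instance (N p q : ℕ) : Fintype (WPrimary N p q) := Fintype.ofFinite _

instance (N p q : ℕ) : DecidableEq (WPrimary N p q) := Classical.decEq _

/-- The primary `[x y]` of `W_N(p, q)`. -/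
def wClass {N p q : ℕ} (x : Weight N p) (y : Weight N q) : WPrimary N p q :=
  Quotient.mk (orbitSetoid N p q) (x, y)

/-! ### The modular data of `W_N(p, q)` -/

/-- The entry of the `S`-matrix of `W_N(p, q)` at the classes of the pairs `a = (x, y)` and
`b = (z, w)`:
`exp(-2πi (t(x) t(w) + t(y) t(z)) / N) S^{(N; p/q)}(x, z) S^{(N; q/p)}(y, w)`, normalised. -/
def wSEntry {N p q : ℕ} (a b : Weight N p × Weight N q) : ℂ :=
  1 / ((Real.sqrt (N * ((p : ℝ) * q) ^ (N - 1)) : ℝ) : ℂ) *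
    exp (-(2 * Real.pi * I *
      (ality a.1.1 * ality b.2.1 + ality a.2.1 * ality b.1.1) / N)) *
    kacPeterson N ((p : ℚ) / q) a.1.1 b.1.1 * kacPeterson N ((q : ℚ) / p) a.2.1 b.2.1

/-- The diagonal entry of the `T`-matrix of `W_N(p, q)` at the class of the pair `a = (x, y)`:
`exp(-πi (N - 1) / 12) exp(πi (q x - p y)² / (p q))`. -/
def wTEntry {N p q : ℕ} (a : Weight N p × Weight N q) : ℂ :=
  exp (-(Real.pi * I * ((N : ℂ) - 1) / 12)) *
    exp (Real.pi * I *
      dot (fun i => (q : ℤ) * a.1.1 i - p * a.2.1 i) (fun i => (q : ℤ) * a.1.1 i - p * a.2.1 i)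
        / (p * q))

/-! The entries depend only on the classes. -/

theorem bracket_eq_sum {N : ℕ} (x : Fin N → ℤ) (i : Fin N) :
    bracket x i = ∑ l, if i < l then x l else 0 := by
  unfold bracket
  rw [← Finset.sum_filter]
  congr 1
  ext l
  simp

theorem sum_bracket_mul {N : ℕ} (x y : Fin N → ℤ) :
    ∑ i, bracket x i * bracket y i =
      ∑ k : Fin N, ∑ l : Fin N, ((min (k : ℕ) (l : ℕ) : ℕ) : ℤ) * x k * y l := by
  simp only [bracket_eq_sum, Finset.sum_mul_sum]
  rw [Finset.sum_comm]
  refine Finset.sum_congr rfl fun k _ => ?_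
  rw [Finset.sum_comm]
  refine Finset.sum_congr rfl fun l _ => ?_
  have : ∀ i : Fin N, ((if i < k then x k else 0) * if i < l then y l else 0) =
      if i < min k l then x k * y l else 0 := by
    intro i
    by_cases h1 : i < k <;> by_cases h2 : i < l <;> simp [h1, h2]
  simp only [this]
  rw [← Finset.sum_filter, Finset.sum_const]
  have h2 : (Finset.univ.filter fun i : Fin N => i < min k l) = Finset.Iio (min k l) := by
    ext; simp
  rw [h2, Fin.card_Iio, nsmul_eq_mul, mul_assoc]
  congr 2

theorem sum_bracket {N : ℕ} (x : Fin N → ℤ) : ∑ i, bracket x i = ality x := by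
  simp only [bracket_eq_sum, ality]
  rw [Finset.sum_comm]
  refine Finset.sum_congr rfl fun k _ => ?_
  rw [← Finset.sum_filter, Finset.sum_const]
  have h2 : (Finset.univ.filter fun i : Fin N => i < k) = Finset.Iio k := by
    ext; simp
  rw [h2, Fin.card_Iio, nsmul_eq_mul]

theorem dot_eq {N : ℕ} (x y : Fin N → ℤ) :
    dot x y = ((∑ i, bracket x i * bracket y i : ℤ) : ℚ) - ality x * ality y / N := by
  rcases Nat.eq_zero_or_pos N with rfl | hN
  · simp [dot, ality]
  have hN' : (N : ℚ) ≠ 0 := by positivity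
  rw [sum_bracket_mul, dot, ality, ality]
  push_cast
  rw [Finset.sum_mul_sum, Finset.sum_div, ← Finset.sum_sub_distrib]
  refine Finset.sum_congr rfl fun k _ => ?_
  rw [Finset.sum_div, ← Finset.sum_sub_distrib]
  refine Finset.sum_congr rfl fun l _ => ?_
  rcases le_total (k : ℚ) (l : ℚ) with h | h
  · rw [min_eq_left h, max_eq_right h]; field_simp
  · rw [min_eq_right h, max_eq_left h]; field_simp

theorem bracket_shift {m : ℕ} (x : Fin (m + 1) → ℤ) (i : Fin (m + 1)) :
    bracket (x ∘ (finRotate (m + 1)).symm) (finRotate (m + 1) i) =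
      bracket x i - x (Fin.last m) + if i = Fin.last m then ∑ l, x l else 0 := by
  have hs : ∀ k : Fin m, (finRotate (m + 1)).symm k.succ = k.castSucc := fun k => by
    rw [Equiv.symm_apply_eq]; simp
  rw [bracket_eq_sum, bracket_eq_sum, Fin.sum_univ_succ]
  simp only [Function.comp, hs, Fin.not_lt_zero, if_false, zero_add]
  induction i using Fin.lastCases with
  | last =>
    have : ∀ l : Fin (m + 1), ¬ Fin.last m < l := fun l => not_lt.mpr (Fin.le_last l)
    simp [this, Fin.sum_univ_castSucc]
  | cast j =>
    rw [Fin.sum_univ_castSucc]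
    simp [Fin.castSucc_ne_last]

theorem ality_shift {m : ℕ} (x : Fin (m + 1) → ℤ) :
    ality (x ∘ (finRotate (m + 1)).symm) =
      ality x - ((m + 1 : ℕ) : ℤ) * x (Fin.last m) + ∑ l, x l := by
  rw [← sum_bracket, ← sum_bracket, ← Equiv.sum_comp (finRotate (m + 1))]
  simp only [bracket_shift]
  rw [Finset.sum_add_distrib, Finset.sum_sub_distrib]
  simp

theorem dot_shift {m : ℕ} (x : Fin (m + 1) → ℤ) (hx : ∑ l, x l = 0) :
    dot (x ∘ (finRotate (m + 1)).symm) (x ∘ (finRotate (m + 1)).symm) = dot x x := by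
  have hN : ((m : ℚ) + 1) ≠ 0 := by positivity
  have h1 : ∑ i, bracket (x ∘ (finRotate (m + 1)).symm) i *
      bracket (x ∘ (finRotate (m + 1)).symm) i =
      ∑ i, bracket x i * bracket x i - 2 * x (Fin.last m) * ality x +
        ((m + 1 : ℕ) : ℤ) * x (Fin.last m) ^ 2 := by
    rw [← Equiv.sum_comp (finRotate (m + 1)), ← sum_bracket x, Finset.mul_sum,
      ← Finset.sum_sub_distrib]
    have h2 : ((m + 1 : ℕ) : ℤ) * x (Fin.last m) ^ 2 =
        ∑ _i : Fin (m + 1), x (Fin.last m) ^ 2 := by simp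
    rw [h2, ← Finset.sum_add_distrib]
    refine Finset.sum_congr rfl fun i _ => ?_
    simp only [bracket_shift, hx, ite_self]
    ring
  rw [dot_eq, dot_eq, h1, ality_shift, hx]
  push_cast
  field_simp
  ring

theorem kacPeterson_comm (N : ℕ) (n : ℚ) (x y : Fin N → ℤ) :
    kacPeterson N n x y = kacPeterson N n y x := by
  unfold kacPeterson
  congr 1
  · congr 1; ring
  · rw [← Matrix.det_transpose]
    congr 1
    ext i j
    simp only [Matrix.transpose_apply, Matrix.of_apply]
    congr 1; ring

theorem kacPeterson_shift {m : ℕ} (n : ℚ) (hn : n ≠ 0) (x y : Fin (m + 1) → ℤ) (k : ℤ)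
    (hk : ((∑ l, x l : ℤ) : ℚ) = k * n) :
    kacPeterson (m + 1) n (x ∘ (finRotate (m + 1)).symm) y =
      (-1) ^ m * exp (2 * Real.pi * I * k * ality y / ((m + 1 : ℕ) : ℂ)) *
        kacPeterson (m + 1) n x y := by
  have hn' : (n : ℂ) ≠ 0 := by exact_mod_cast hn
  have hN : ((m : ℂ) + 1) ≠ 0 := by exact_mod_cast Nat.succ_ne_zero m
  have hk' : ((∑ l, x l : ℤ) : ℂ) = k * n := by exact_mod_cast congrArg (Rat.cast : ℚ → ℂ) hk
  set x' := x ∘ (finRotate (m + 1)).symm with hx'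
  set A' : Matrix (Fin (m + 1)) (Fin (m + 1)) ℂ :=
    Matrix.of fun i j => exp (-(2 * Real.pi * I * bracket x' i * bracket y j / n)) with hA'
  set A : Matrix (Fin (m + 1)) (Fin (m + 1)) ℂ :=
    Matrix.of fun i j => exp (-(2 * Real.pi * I * bracket x i * bracket y j / n)) with hA
  have hsub : A'.submatrix (finRotate (m + 1)) id =
      A * Matrix.diagonal fun j => exp (2 * Real.pi * I * x (Fin.last m) * bracket y j / n) := by
    ext i j
    rw [Matrix.mul_diagonal, hA', hA, Matrix.submatrix_apply, Matrix.of_apply, Matrix.of_apply,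
      hx', bracket_shift, ← Complex.exp_add, id]
    split_ifs with h
    · rw [Complex.exp_eq_exp_iff_exists_int]
      refine ⟨-(k * bracket y j), ?_⟩
      rw [Int.cast_add, hk']
      push_cast
      field_simp
      ring
    · congr 1
      push_cast
      ring
  have hdet : (-1) ^ m * A'.det =
      A.det * exp (2 * Real.pi * I * x (Fin.last m) * ality y / n) := by
    have h := congrArg Matrix.det hsub
    rw [Matrix.det_permute, Matrix.det_mul, Matrix.det_diagonal, sign_finRotate,
      ← Complex.exp_sum] at h
    rw [← sum_bracket y]
    push_cast at h ⊢
    rw [h, Finset.mul_sum, Finset.sum_div]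
  have hdet' : A'.det =
      (-1) ^ m * (A.det * exp (2 * Real.pi * I * x (Fin.last m) * ality y / n)) := by
    rw [← hdet, ← mul_assoc, ← mul_pow]
    simp
  unfold kacPeterson
  rw [← hA', ← hA, hdet', hx', ality_shift, Int.cast_add, hk']
  have : exp (2 * Real.pi * I *
        (((ality x - ((m + 1 : ℕ) : ℤ) * x (Fin.last m) : ℤ) : ℂ) + k * n) * ality y /
          (((m + 1 : ℕ) : ℂ) * n)) *
        exp (2 * Real.pi * I * x (Fin.last m) * ality y / n) =
      exp (2 * Real.pi * I * k * ality y / ((m + 1 : ℕ) : ℂ)) *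
        exp (2 * Real.pi * I * ality x * ality y / (((m + 1 : ℕ) : ℂ) * n)) := by
    rw [← Complex.exp_add, ← Complex.exp_add]
    congr 1
    push_cast
    field_simp
    ring
  linear_combination ((-1) ^ m * A.det) * this

theorem wSEntry_comm {N p q : ℕ} (a b : Weight N p × Weight N q) :
    wSEntry a b = wSEntry b a := by
  unfold wSEntry
  rw [kacPeterson_comm N _ a.1.1, kacPeterson_comm N _ a.2.1]
  congr 4
  ring

theorem weight_pos {m n : ℕ} (x : Weight (m + 1) n) : 0 < n := by
  have h : (0 : ℤ) < n := by
    rw [← x.sum_eq]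
    exact Finset.sum_pos (fun i _ => x.pos i) ⟨0, Finset.mem_univ 0⟩
  exact_mod_cast h

theorem wSEntry_shift {N p q : ℕ} (a b : Weight N p × Weight N q) :
    wSEntry (simpleCurrentPair N p q a) b = wSEntry a b := by
  rcases N with _ | m
  · have h : simpleCurrentPair 0 p q a = a :=
      Prod.ext (Weight.ext (Subsingleton.elim _ _)) (Weight.ext (Subsingleton.elim _ _))
    rw [h]
  have hp : (p : ℚ) ≠ 0 := by exact_mod_cast (weight_pos a.1).ne'
  have hq : (q : ℚ) ≠ 0 := by exact_mod_cast (weight_pos a.2).ne'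
  have hN : ((m : ℂ) + 1) ≠ 0 := by exact_mod_cast Nat.succ_ne_zero m
  have h1 : (simpleCurrentPair (m + 1) p q a).1.1 = a.1.1 ∘ (finRotate (m + 1)).symm := rfl
  have h2 : (simpleCurrentPair (m + 1) p q a).2.1 = a.2.1 ∘ (finRotate (m + 1)).symm := rfl
  unfold wSEntry
  rw [h1, h2, kacPeterson_shift _ (div_ne_zero hp hq) a.1.1 b.1.1 q
      (by rw [a.1.sum_eq]; push_cast; field_simp),
    kacPeterson_shift _ (div_ne_zero hq hp) a.2.1 b.2.1 p
      (by rw [a.2.sum_eq]; push_cast; field_simp),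
    ality_shift, ality_shift, a.1.sum_eq, a.2.sum_eq]
  have hexp : exp (-(2 * Real.pi * I *
        (((ality a.1.1 - ((m + 1 : ℕ) : ℤ) * a.1.1 (Fin.last m) + (p : ℤ) : ℤ) : ℂ) *
            ality b.2.1 +
          ((ality a.2.1 - ((m + 1 : ℕ) : ℤ) * a.2.1 (Fin.last m) + (q : ℤ) : ℤ) : ℂ) *
            ality b.1.1) / ((m + 1 : ℕ) : ℂ))) *
        (exp (2 * Real.pi * I * ((q : ℤ) : ℂ) * ality b.1.1 / ((m + 1 : ℕ) : ℂ)) *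
          exp (2 * Real.pi * I * ((p : ℤ) : ℂ) * ality b.2.1 / ((m + 1 : ℕ) : ℂ))) =
      exp (-(2 * Real.pi * I *
        (ality a.1.1 * ality b.2.1 + ality a.2.1 * ality b.1.1) / ((m + 1 : ℕ) : ℂ))) := by
    rw [← Complex.exp_add, ← Complex.exp_add, Complex.exp_eq_exp_iff_exists_int]
    refine ⟨a.1.1 (Fin.last m) * ality b.2.1 + a.2.1 (Fin.last m) * ality b.1.1, ?_⟩
    push_cast
    field_simp
    ring
  have hsq : ((-1 : ℂ) ^ m) * (-1) ^ m = 1 := by rw [← mul_pow]; simp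
  rw [← hexp]
  linear_combination (1 / ((Real.sqrt (((m + 1 : ℕ) : ℝ) * ((p : ℝ) * q) ^ (m + 1 - 1)) : ℝ) : ℂ) *
    exp (-(2 * Real.pi * I *
        (((ality a.1.1 - ((m + 1 : ℕ) : ℤ) * a.1.1 (Fin.last m) + (p : ℤ) : ℤ) : ℂ) *
            ality b.2.1 +
          ((ality a.2.1 - ((m + 1 : ℕ) : ℤ) * a.2.1 (Fin.last m) + (q : ℤ) : ℤ) : ℂ) *
            ality b.1.1) / ((m + 1 : ℕ) : ℂ))) *
        (exp (2 * Real.pi * I * ((q : ℤ) : ℂ) * ality b.1.1 / ((m + 1 : ℕ) : ℂ)) *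
          exp (2 * Real.pi * I * ((p : ℤ) : ℂ) * ality b.2.1 / ((m + 1 : ℕ) : ℂ))) *
    kacPeterson (m + 1) ((p : ℚ) / q) a.1.1 b.1.1 *
    kacPeterson (m + 1) ((q : ℚ) / p) a.2.1 b.2.1) * hsq

theorem wTEntry_shift {N p q : ℕ} (a : Weight N p × Weight N q) :
    wTEntry (simpleCurrentPair N p q a) = wTEntry a := by
  rcases N with _ | m
  · have h : simpleCurrentPair 0 p q a = a :=
      Prod.ext (Weight.ext (Subsingleton.elim _ _)) (Weight.ext (Subsingleton.elim _ _))
    rw [h]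
  have h := dot_shift (fun i => (q : ℤ) * a.1.1 i - p * a.2.1 i) (by
    rw [Finset.sum_sub_distrib, ← Finset.mul_sum, ← Finset.mul_sum, a.1.sum_eq, a.2.sum_eq]; ring)
  unfold wTEntry
  rw [← h]
  rfl

/-- A function of pairs that is invariant under `JK` is constant on `⟨JK⟩`-orbits. -/
theorem orbit_lift {N p q : ℕ} {β : Type*} (f : Weight N p × Weight N q → β)
    (hf : ∀ a, f (simpleCurrentPair N p q a) = f a) (a b : Weight N p × Weight N q)
    (h : (orbitSetoid N p q).r a b) : f a = f b := by
  obtain ⟨i, rfl⟩ := h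
  have hz : ∀ i : ℤ, ∀ a, f ((simpleCurrentPair N p q ^ i) a) = f a := by
    intro i
    induction i using Int.induction_on with
    | zero => intro a; simp
    | succ i ih => intro a; rw [zpow_add_one, Equiv.Perm.mul_apply, ih, hf]
    | pred i ih =>
      intro a
      rw [zpow_sub_one, Equiv.Perm.mul_apply, ih]
      conv_rhs => rw [← Equiv.apply_symm_apply (simpleCurrentPair N p q) a, hf]
      rfl
  exact (hz i a).symm

/-- The `S`-matrix of `W_N(p, q)`, indexed by the `⟨JK⟩`-orbits. -/
def wS (N p q : ℕ) : Matrix (WPrimary N p q) (WPrimary N p q) ℂ :=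
  Matrix.of fun a b =>
    Quotient.lift₂ (s₁ := orbitSetoid N p q) (s₂ := orbitSetoid N p q) wSEntry
      (fun a₁ b₁ a₂ b₂ ha hb => by
        have e1 : wSEntry a₁ b₁ = wSEntry a₂ b₁ :=
          orbit_lift (fun a => wSEntry a b₁) (fun a => wSEntry_shift a b₁) a₁ a₂ ha
        have e2 : wSEntry b₁ a₂ = wSEntry b₂ a₂ :=
          orbit_lift (fun b => wSEntry b a₂) (fun b => wSEntry_shift b a₂) b₁ b₂ hb
        rw [e1, wSEntry_comm, e2, wSEntry_comm]) a b

/-- The diagonal `T`-matrix of `W_N(p, q)`, indexed by the `⟨JK⟩`-orbits. -/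
def wT (N p q : ℕ) : Matrix (WPrimary N p q) (WPrimary N p q) ℂ :=
  Matrix.diagonal fun a =>
    Quotient.lift (s := orbitSetoid N p q) wTEntry
      (fun a b h => orbit_lift wTEntry wTEntry_shift a b h) a

/-- `M` is a modular invariant of the minimal model `W_N(p, q)`, whose vacuum is `[ρ ρ]`. -/
def IsWModularInvariant {N p q : ℕ} (hN : 0 < N) (hp : N ≤ p) (hq : N ≤ q)
    (M : Matrix (WPrimary N p q) (WPrimary N p q) ℕ) : Prop :=
  IsModularInvariant (wS N p q) (wT N p q) (wClass (rho hN hp) (rho hN hq)) M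

/-- `M` is a modular invariant of `SU(N)` at height `n`, i.e. at level `n - N`; its vacuum
is `ρ`. -/
def IsSUModularInvariant {N n : ℕ} (hN : 0 < N) (h : N ≤ n)
    (M : Matrix (Weight N n) (Weight N n) ℕ) : Prop :=
  IsModularInvariant (suS N n) (suT N n) (rho hN h) M

end WNModel

end

/-!
At height `q = N + 1` a weight has one extended Dynkin label equal to `2` and all others equal to
`1`, so the simple current `K` permutes the `N` weights simply transitively. Hence every
`⟨JK⟩`-orbit contains exactly one pair `(x, ρ)`, and `x ↦ [x ρ]` identifies the primaries of
`SU(N)` at height `p` with those of `W_N(p, N + 1)` (`wClass_rho_bijective`), vacuum to vacuum. It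
remains to see that under this identification a nonnegative integer matrix `M` commutes with one
pair `S`, `T` iff it commutes with the other (`isModularInvariant_wEntry_iff`).

*The `T`-matrices.* Commuting with a diagonal matrix means that the support of `M` only joins
primaries of equal eigenvalue. For `SU(N)` the condition on `x`, `y` is `x² ≡ y² mod 2p`; for
`W_N(p, q)` it is `q x² + p (N - 1) t(x) ≡ q y² + p (N - 1) t(y) mod 2p`, because
`2 x · ρ ≡ (N - 1) t(x) mod 2`. Since `N x² ≡ -t(x)² mod N`, and `q ≡ 1 mod N`, either one gives
`t(x)² ≡ t(y)² mod N`, so that `(N - 1) t(x)` and `(N - 1) t(y)` have the same parity, and then the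
two are equivalent because `q` is prime to `p` (`suT_eq_iff_wTEntry_eq`).

*The `S`-matrices.* In the representatives `[x ρ]` the `S`-matrix of `W_N(p, q)` is
`c ε(x) ε(y) D^{(p/q)}`, where `c` contains the entry of `D^{(q/p)}` at `(ρ, ρ)`, a nonzero
Vandermonde determinant (`kacPeterson_rho_ne_zero`), and `ε(x) = (-1)^{(N - 1) t(x)}`. By the
parity statement `ε` is constant along the support of `M`, so it drops out of the commutation
relation (`twist_mul_natCast_comm_iff`). Finally `D^{(p/q)}` arises from `D^{(p)}` by replacing the
primitive `Np`-th root of unity `exp(2πi/(Np))` by its `q`-th power. As `q` is prime to `Np` this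
is a Galois conjugation, and it preserves commutation with integer matrices
(`kacPetersonAt_comm_iff`).
-/

namespace WNModel

open Complex

/-! ### Modular invariants and matrix manipulations -/

theorem isModularInvariant_submatrix {Φ Ψ : Type*} [Fintype Φ] [Fintype Ψ] (e : Ψ ≃ Φ)
    (S T : Matrix Φ Φ ℂ) (o : Ψ) (M : Matrix Φ Φ ℕ) :
    IsModularInvariant (S.submatrix e e) (T.submatrix e e) o (M.submatrix e e) ↔
      IsModularInvariant S T (e o) M := by
  have key : ∀ A B : Matrix Φ Φ ℂ,
      A.submatrix e e = B.submatrix e e ↔ A = B := fun A B =>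
    (Matrix.reindex e.symm e.symm).injective.eq_iff (a := A) (b := B)
  unfold IsModularInvariant
  rw [Matrix.submatrix_apply, ← Matrix.submatrix_map, Matrix.submatrix_mul_equiv,
    Matrix.submatrix_mul_equiv, Matrix.submatrix_mul_equiv, Matrix.submatrix_mul_equiv, key, key]

theorem diagonal_mul_natCast_comm_iff {Φ : Type*} [Fintype Φ] [DecidableEq Φ] (d : Φ → ℂ)
    (M : Matrix Φ Φ ℕ) :
    Matrix.diagonal d * M.map (Nat.cast : ℕ → ℂ) = M.map (Nat.cast : ℕ → ℂ) * Matrix.diagonal d ↔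
      ∀ x y, M x y ≠ 0 → d x = d y := by
  rw [← Matrix.ext_iff]
  refine forall₂_congr fun x y => ?_
  rw [Matrix.diagonal_mul, Matrix.mul_diagonal, Matrix.map_apply, mul_comm, mul_eq_mul_left_iff,
    Nat.cast_eq_zero, or_comm, or_iff_not_imp_left]

/-- Conjugating `S` by a diagonal matrix that commutes with `M`, and rescaling it, does not affect
whether `S` commutes with `M`. -/
theorem twist_mul_natCast_comm_iff {Φ : Type*} [Fintype Φ] {S S' : Matrix Φ Φ ℂ}
    {M : Matrix Φ Φ ℕ} {c : ℂ} {e : Φ → ℂ} (hc : c ≠ 0) (he : ∀ x, e x ≠ 0)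
    (hM : ∀ x y, M x y ≠ 0 → e x = e y) (hS : ∀ x y, S' x y = c * e x * e y * S x y) :
    S' * M.map (Nat.cast : ℕ → ℂ) = M.map (Nat.cast : ℕ → ℂ) * S' ↔
      S * M.map (Nat.cast : ℕ → ℂ) = M.map (Nat.cast : ℕ → ℂ) * S := by
  rw [← Matrix.ext_iff, ← Matrix.ext_iff]
  refine forall₂_congr fun x y => ?_
  have h1 : (S' * M.map (Nat.cast : ℕ → ℂ)) x y =
      c * e x * e y * (S * M.map (Nat.cast : ℕ → ℂ)) x y := by
    rw [Matrix.mul_apply, Matrix.mul_apply, Finset.mul_sum]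
    refine Finset.sum_congr rfl fun k _ => ?_
    rw [hS, Matrix.map_apply]
    by_cases h : M k y = 0
    · simp [h]
    · rw [hM k y h]; ring
  have h2 : (M.map (Nat.cast : ℕ → ℂ) * S') x y =
      c * e x * e y * (M.map (Nat.cast : ℕ → ℂ) * S) x y := by
    rw [Matrix.mul_apply, Matrix.mul_apply, Finset.mul_sum]
    refine Finset.sum_congr rfl fun k _ => ?_
    rw [hS, Matrix.map_apply]
    by_cases h : M x k = 0
    · simp [h]
    · rw [hM x k h]; ring
  rw [h1, h2]
  exact mul_right_inj' (mul_ne_zero (mul_ne_zero hc (he x)) (he y))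

/-! ### Galois conjugation of the `S`-matrix -/

/-- The Kac–Peterson determinant as a Laurent polynomial in `z`, evaluated in any field. At
`z = exp(2πi / (N n))` it is the unnormalised `S`-matrix at height `n`. -/
def kacPetersonAt {K : Type*} [Field K] {N : ℕ} (z : K) (x y : Fin N → ℤ) : K :=
  z ^ (ality x * ality y) *
    (Matrix.of fun i j : Fin N => z ^ (-(N * bracket x i * bracket y j) : ℤ)).det

theorem map_kacPetersonAt {K L : Type*} [Field K] [Field L] (f : K →+* L) {N : ℕ} (z : K)
    (x y : Fin N → ℤ) : f (kacPetersonAt z x y) = kacPetersonAt (f z) x y := by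
  unfold kacPetersonAt
  rw [map_mul, map_zpow₀, RingHom.map_det]
  congr 2
  ext i j
  simp

theorem kacPeterson_eq_kacPetersonAt {N : ℕ} (hN : N ≠ 0) (n : ℚ) (x y : Fin N → ℤ) :
    kacPeterson N n x y = kacPetersonAt (exp (2 * Real.pi * I / (N * n))) x y := by
  have hN' : (N : ℂ) ≠ 0 := by exact_mod_cast hN
  unfold kacPeterson kacPetersonAt
  congr 1
  · rw [← exp_int_mul]
    congr 1
    push_cast
    ring
  · congr 1
    ext i j
    rw [Matrix.of_apply, Matrix.of_apply, ← exp_int_mul]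
    congr 1
    -- For `n = 0` both exponents are `0`, by the convention `a / 0 = 0`.
    rcases eq_or_ne (n : ℂ) 0 with h | h
    · simp [h]
    · push_cast
      field_simp

/-- A matrix with integer entries commutes with the Kac–Peterson matrix at one primitive root of
unity iff it does so at any other of the same order: both are images of a single matrix over
the cyclotomic field. -/
theorem kacPetersonAt_comm_iff {N : ℕ} {Φ : Type*} [Fintype Φ] [DecidableEq Φ] (v : Φ → Fin N → ℤ)
    (M : Matrix Φ Φ ℕ) {n : ℕ} (hn : 0 < n) {z w : ℂ} (hz : IsPrimitiveRoot z n)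
    (hw : IsPrimitiveRoot w n) :
    (Matrix.of fun x y => kacPetersonAt z (v x) (v y)) * M.map (Nat.cast : ℕ → ℂ) =
        M.map (Nat.cast : ℕ → ℂ) * (Matrix.of fun x y => kacPetersonAt z (v x) (v y)) ↔
      (Matrix.of fun x y => kacPetersonAt w (v x) (v y)) * M.map (Nat.cast : ℕ → ℂ) =
        M.map (Nat.cast : ℕ → ℂ) * (Matrix.of fun x y => kacPetersonAt w (v x) (v y)) := by
  have : NeZero n := ⟨hn.ne'⟩
  have : IsCyclotomicExtension {n} ℚ (CyclotomicField n ℚ) :=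
    CyclotomicField.isCyclotomicExtension n ℚ
  set ζ := IsCyclotomicExtension.zeta n ℚ (CyclotomicField n ℚ)
  have hζ : IsPrimitiveRoot ζ n := IsCyclotomicExtension.zeta_spec n ℚ (CyclotomicField n ℚ)
  have key : ∀ u : ℂ, IsPrimitiveRoot u n →
      ((Matrix.of fun x y => kacPetersonAt ζ (v x) (v y)) *
            M.map (Nat.cast : ℕ → CyclotomicField n ℚ) =
          M.map (Nat.cast : ℕ → CyclotomicField n ℚ) *
            (Matrix.of fun x y => kacPetersonAt ζ (v x) (v y)) ↔
        (Matrix.of fun x y => kacPetersonAt u (v x) (v y)) * M.map (Nat.cast : ℕ → ℂ) =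
          M.map (Nat.cast : ℕ → ℂ) *
            (Matrix.of fun x y => kacPetersonAt u (v x) (v y))) := by
    intro u hu
    let E := hζ.embeddingsEquivPrimitiveRoots ℂ (Polynomial.cyclotomic.irreducible_rat hn)
    let u' : primitiveRoots n ℂ := ⟨u, (mem_primitiveRoots hn).2 hu⟩
    obtain ⟨f, hf⟩ : ∃ f : CyclotomicField n ℚ →+* ℂ, f ζ = u :=
      ⟨(E.symm u' : CyclotomicField n ℚ →ₐ[ℚ] ℂ), congrArg Subtype.val (E.apply_symm_apply u')⟩
    have hmap : f.mapMatrix (Matrix.of fun x y => kacPetersonAt ζ (v x) (v y)) =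
        Matrix.of fun x y => kacPetersonAt u (v x) (v y) := by
      ext x y
      simp [map_kacPetersonAt, hf]
    have hM : f.mapMatrix (M.map (Nat.cast : ℕ → CyclotomicField n ℚ)) =
        M.map (Nat.cast : ℕ → ℂ) := by
      ext x y
      simp
    have hinj : Function.Injective (f.mapMatrix (m := Φ)) := by
      intro A B h
      ext x y
      exact f.injective (congrFun (congrFun h x) y)
    rw [← hinj.eq_iff, map_mul, map_mul, hmap, hM]
  rw [← key z hz, ← key w hw]

/-! ### The `⟨JK⟩`-orbits when `q = N + 1` -/

theorem rho_val {N n : ℕ} (hN : 0 < N) (h : N ≤ n) (i : Fin N) :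
    (rho hN h).1 i = if (i : ℕ) = 0 then (n : ℤ) - N + 1 else 1 := rfl

theorem simpleCurrent_pow_val (N n k : ℕ) (x : Weight N n) :
    ((simpleCurrent N n ^ k) x).1 = x.1 ∘ ((finRotate N ^ k).symm : Fin N → Fin N) := by
  induction k generalizing x with
  | zero => rfl
  | succ k ih =>
    rw [pow_succ, Equiv.Perm.mul_apply, ih, pow_succ]
    rfl

theorem simpleCurrentPair_pow_apply (N p q k : ℕ) (a : Weight N p × Weight N q) :
    (simpleCurrentPair N p q ^ k) a =
      ((simpleCurrent N p ^ k) a.1, (simpleCurrent N q ^ k) a.2) := by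
  induction k generalizing a with
  | zero => rfl
  | succ k ih =>
    rw [pow_succ, Equiv.Perm.mul_apply, ih, pow_succ, pow_succ]
    rfl

/-- At height `N + 1` one extended Dynkin label is `2` and the others are `1`. -/
theorem Weight.exists_val_eq_ite {N : ℕ} (y : Weight N (N + 1)) :
    ∃ i, ∀ j, y.1 j = if j = i then 2 else 1 := by
  have hsum : ∑ j, (y.1 j - 1) = 1 := by
    rw [Finset.sum_sub_distrib, y.sum_eq]
    simp
  obtain ⟨i, hi⟩ : ∃ i, y.1 i ≠ 1 := by
    by_contra! h
    simp [h] at hsum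
  have hnn : ∀ j, 0 ≤ y.1 j - 1 := fun j => by have := y.pos j; omega
  have hi2 : 2 ≤ y.1 i := by have := y.pos i; omega
  refine ⟨i, fun j => ?_⟩
  rw [← Finset.add_sum_erase _ _ (Finset.mem_univ i)] at hsum
  split_ifs with hj
  · subst hj
    have := Finset.sum_nonneg (s := Finset.univ.erase j) fun k _ => hnn k
    omega
  · have := Finset.single_le_sum (s := Finset.univ.erase i) (fun k _ => hnn k)
      (Finset.mem_erase.2 ⟨hj, Finset.mem_univ j⟩)
    have := hnn j
    omega

theorem exists_simpleCurrent_pow_eq_rho {N : ℕ} (hN : 2 ≤ N) (y : Weight N (N + 1)) :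
    ∃ k : ℕ, (simpleCurrent N (N + 1) ^ k) y = rho (two_pos.trans_le hN) (Nat.le_succ N) := by
  obtain ⟨m, rfl⟩ : ∃ m, N = m + 2 := ⟨N - 2, by omega⟩
  obtain ⟨i, hi⟩ := y.exists_val_eq_ite
  have hmove : ∀ j, finRotate (m + 2) j ≠ j := fun j => by
    rw [← Equiv.Perm.mem_support, support_finRotate]
    exact Finset.mem_univ j
  obtain ⟨k, hk⟩ := isCycle_finRotate.exists_pow_eq (hmove i) (hmove 0)
  refine ⟨k, Weight.ext (funext fun j => ?_)⟩
  rw [simpleCurrent_pow_val, Function.comp_apply, hi, rho_val]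
  simp only [Equiv.symm_apply_eq, hk, Fin.ext_iff, Fin.val_zero]
  split_ifs
  · push_cast; ring
  · rfl

/-- The action of `⟨K⟩` on the weights of height `N + 1` is free: a power fixing `ρ` is a trivial
rotation of the labels, hence acts trivially at every height. -/
theorem simpleCurrent_pow_eq_one {N k : ℕ} (hN : 2 ≤ N) (n : ℕ)
    (h : (simpleCurrent N (N + 1) ^ k) (rho (two_pos.trans_le hN) (Nat.le_succ N)) =
      rho (two_pos.trans_le hN) (Nat.le_succ N)) :
    simpleCurrent N n ^ k = 1 := by
  obtain ⟨m, rfl⟩ : ∃ m, N = m + 2 := ⟨N - 2, by omega⟩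
  have hmove : finRotate (m + 2) 0 ≠ 0 := by
    rw [← Equiv.Perm.mem_support, support_finRotate]
    exact Finset.mem_univ _
  have h0 := congrFun (congrArg Weight.val h) 0
  rw [simpleCurrent_pow_val, Function.comp_apply, rho_val, rho_val] at h0
  have hfix : (finRotate (m + 2) ^ k).symm 0 = 0 := by
    -- A label moved to position `0` from elsewhere would be `1`, while `ρ` has label `2` there.
    by_contra hne
    have hne' : ((finRotate (m + 2) ^ k).symm 0 : Fin (m + 2)).val ≠ 0 := fun h => hne (Fin.ext h)
    rw [if_neg hne'] at h0
    simp at h0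
  have hone : finRotate (m + 2) ^ k = 1 :=
    isCycle_finRotate.pow_eq_one_iff.2 ⟨0, hmove, ((Equiv.symm_apply_eq _).1 hfix).symm⟩
  refine Equiv.ext fun x => Weight.ext ?_
  rw [simpleCurrent_pow_val, hone]
  rfl

/-- `⟨K⟩` acts simply transitively on the weights of height `N + 1`, so every `⟨JK⟩`-orbit
contains exactly one pair of the form `(x, ρ)`. -/
theorem wClass_rho_bijective {N : ℕ} (p : ℕ) (hN : 2 ≤ N) :
    Function.Bijective fun x : Weight N p =>
      wClass x (rho (n := N + 1) (two_pos.trans_le hN) (Nat.le_succ N)) := by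
  constructor
  · intro x y h
    obtain ⟨k, -, hk⟩ := Equiv.Perm.SameCycle.exists_pow_eq' (Quotient.exact h)
    rw [simpleCurrentPair_pow_apply, Prod.ext_iff] at hk
    have h1 := hk.1
    rwa [simpleCurrent_pow_eq_one hN p hk.2] at h1
  · intro c
    induction c using Quotient.inductionOn with
    | h a =>
      obtain ⟨k, hk⟩ := exists_simpleCurrent_pow_eq_rho hN a.2
      refine ⟨(simpleCurrent N p ^ k) a.1, Quotient.sound ?_⟩
      refine Equiv.Perm.SameCycle.symm ⟨k, ?_⟩
      rw [zpow_natCast, simpleCurrentPair_pow_apply, hk]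

/-! ### The Weyl vector -/

theorem bracket_rho {N n : ℕ} (hN : 0 < N) (h : N ≤ n) (i : Fin N) :
    bracket (rho hN h).1 i = (N : ℤ) - 1 - i := by
  have h1 : bracket (rho hN h).1 i = ∑ _l ∈ Finset.Ioi i, (1 : ℤ) := by
    refine Finset.sum_congr rfl fun l hl => ?_
    have : i < l := Finset.mem_Ioi.1 hl
    rw [rho_val, if_neg (by omega)]
  rw [h1, Finset.sum_const, Fin.card_Ioi, nsmul_eq_mul, mul_one]
  have := i.2
  omega

theorem two_mul_ality_rho {N n : ℕ} (hN : 0 < N) (h : N ≤ n) :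
    2 * ality (rho hN h).1 = (N : ℤ) * (N - 1) := by
  have h1 : ality (rho hN h).1 = ∑ i : Fin N, ((i : ℕ) : ℤ) := by
    rw [← sum_bracket, ← Equiv.sum_comp Fin.revPerm]
    refine Finset.sum_congr rfl fun i _ => ?_
    rw [bracket_rho, Fin.revPerm_apply, Fin.val_rev]
    have := i.2
    omega
  rw [h1, Fin.sum_univ_eq_sum_range (fun i => (i : ℤ)), ← Nat.cast_sum]
  have h2 := Finset.sum_range_id_mul_two N
  have h3 : (((∑ i ∈ Finset.range N, i) * 2 : ℕ) : ℤ) = ((N * (N - 1) : ℕ) : ℤ) := by rw [h2]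
  rw [Nat.cast_mul, Nat.cast_mul, Nat.cast_sub hN] at h3
  push_cast at h3 ⊢
  linarith

/-- The vacuum entry is a Vandermonde determinant. -/
theorem kacPetersonAt_rho_ne_zero {K : Type*} [Field K] {N n : ℕ} (hN : 0 < N) (h : N ≤ n)
    {z : K} (hz : z ≠ 0) (hinj : Set.InjOn (fun k : ℕ => (z ^ N) ^ k) (Set.Iio N)) :
    kacPetersonAt z (rho hN h).1 (rho hN h).1 ≠ 0 := by
  unfold kacPetersonAt
  refine mul_ne_zero (zpow_ne_zero _ hz) ?_
  have hV : (Matrix.of fun i j : Fin N =>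
      z ^ (-(N * bracket (rho hN h).1 i * bracket (rho hN h).1 j) : ℤ)) =
      (Matrix.vandermonde fun i : Fin N =>
        ((z ^ N) ^ (i.rev : ℕ))⁻¹).submatrix id Fin.revPerm := by
    ext i j
    rw [Matrix.submatrix_apply, Matrix.vandermonde_apply, Matrix.of_apply, id, Fin.revPerm_apply,
      bracket_rho, bracket_rho, inv_pow, ← pow_mul, ← pow_mul, zpow_neg, ← zpow_natCast]
    congr 2
    rw [Fin.val_rev, Fin.val_rev]
    push_cast [Nat.cast_sub (show (i : ℕ) + 1 ≤ N by omega),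
      Nat.cast_sub (show (j : ℕ) + 1 ≤ N by omega)]
    ring
  rw [hV, Matrix.det_permute', mul_ne_zero_iff]
  refine ⟨?_, Matrix.det_vandermonde_ne_zero_iff.2 fun i j hij => ?_⟩
  · rcases Int.units_eq_one_or (Equiv.Perm.sign (Fin.revPerm (n := N))) with h | h <;> simp [h]
  · exact Fin.rev_injective (Fin.ext (hinj (i.rev.2 : _ ∈ Set.Iio N) (j.rev.2 : _ ∈ Set.Iio N)
      (inv_injective hij)))

theorem kacPeterson_rho_ne_zero {N p : ℕ} (hN : 2 ≤ N) (hp : 0 < p)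
    (hcop : Nat.Coprime p (N + 1)) :
    kacPeterson N (((N + 1 : ℕ) : ℚ) / p)
      (rho (n := N + 1) (two_pos.trans_le hN) (Nat.le_succ N)).1
      (rho (n := N + 1) (two_pos.trans_le hN) (Nat.le_succ N)).1 ≠ 0 := by
  rw [kacPeterson_eq_kacPetersonAt (by omega)]
  refine kacPetersonAt_rho_ne_zero _ _ (exp_ne_zero _) ?_
  have hroot : IsPrimitiveRoot
      (exp (2 * Real.pi * I / (N * (((N + 1 : ℕ) : ℚ) / p : ℚ))) ^ N) (N + 1) := by
    have := isPrimitiveRoot_exp_of_coprime p (N + 1) (by omega) hcop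
    convert this using 1
    rw [← exp_nat_mul]
    congr 1
    have hN' : (N : ℂ) ≠ 0 := by exact_mod_cast (by omega : N ≠ 0)
    have hN1 : (N : ℂ) + 1 ≠ 0 := by exact_mod_cast (by omega : N + 1 ≠ 0)
    have hp' : (p : ℂ) ≠ 0 := by exact_mod_cast hp.ne'
    push_cast
    field_simp
  exact fun i hi j hj hij => hroot.pow_inj (lt_trans hi (Nat.lt_succ_self N))
    (lt_trans hj (Nat.lt_succ_self N)) hij

/-! ### The `T`-matrices -/

theorem dot_self_sub {N : ℕ} (q p : ℤ) (x r : Fin N → ℤ) :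
    dot (fun i => q * x i - p * r i) (fun i => q * x i - p * r i) =
      q ^ 2 * dot x x - 2 * q * p * dot x r + p ^ 2 * dot r r := by
  have hb : ∀ i, bracket (fun i => q * x i - p * r i) i = q * bracket x i - p * bracket r i := by
    intro i
    simp [bracket, Finset.sum_sub_distrib, Finset.mul_sum]
  have ha : ality (fun i => q * x i - p * r i) = q * ality x - p * ality r := by
    rw [← sum_bracket, ← sum_bracket, ← sum_bracket, Finset.mul_sum, Finset.mul_sum,
      ← Finset.sum_sub_distrib]
    exact Finset.sum_congr rfl fun i _ => hb i
  have hs : ∑ i, bracket (fun i => q * x i - p * r i) i * bracket (fun i => q * x i - p * r i) i =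
      q ^ 2 * ∑ i, bracket x i * bracket x i - 2 * q * p * ∑ i, bracket x i * bracket r i +
        p ^ 2 * ∑ i, bracket r i * bracket r i := by
    rw [Finset.mul_sum, Finset.mul_sum, Finset.mul_sum, ← Finset.sum_sub_distrib,
      ← Finset.sum_add_distrib]
    refine Finset.sum_congr rfl fun i _ => ?_
    rw [hb]
    ring
  rw [dot_eq, dot_eq, dot_eq, dot_eq, ha, hs]
  push_cast
  ring

/-- `2 x · ρ` differs from `(N - 1) t(x)` by an even integer. -/
theorem exists_two_mul_dot_rho {N n : ℕ} (hN : 0 < N) (h : N ≤ n) (x : Fin N → ℤ) :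
    ∃ c : ℤ, 2 * dot x (rho hN h).1 = (N - 1 : ℤ) * ality x + 2 * c := by
  refine ⟨∑ i, bracket x i * bracket (rho hN h).1 i - (N - 1) * ality x, ?_⟩
  have hr : 2 * (ality (rho hN h).1 : ℚ) = N * (N - 1) := by
    exact_mod_cast two_mul_ality_rho hN h
  have hN' : (N : ℚ) ≠ 0 := by exact_mod_cast hN.ne'
  rw [dot_eq]
  push_cast
  field_simp
  linear_combination (-(ality x : ℚ)) * hr

theorem exp_rat_eq_exp_rat_iff (c : ℂ) (hc : c ≠ 0) (r s : ℚ) :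
    c * exp (Real.pi * I * r) = c * exp (Real.pi * I * s) ↔ ∃ k : ℤ, r - s = 2 * k := by
  rw [mul_right_inj' hc, exp_eq_exp_iff_exists_int]
  refine exists_congr fun k => ?_
  have hpi : (Real.pi : ℂ) * I ≠ 0 := mul_ne_zero (by exact_mod_cast Real.pi_ne_zero) I_ne_zero
  have h1 : (Real.pi * I * r : ℂ) = Real.pi * I * s + k * (2 * Real.pi * I) ↔
      (r : ℂ) - s = 2 * k := by
    rw [← mul_right_inj' hpi (b := (r : ℂ) - s)]
    constructor <;> intro h <;> linear_combination h
  rw [h1]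
  norm_cast

theorem suT_comm_iff {N p : ℕ} (M : Matrix (Weight N p) (Weight N p) ℕ) :
    suT N p * M.map (Nat.cast : ℕ → ℂ) = M.map (Nat.cast : ℕ → ℂ) * suT N p ↔
      ∀ x y, M x y ≠ 0 → ∃ k : ℤ, dot x.1 x.1 / p - dot y.1 y.1 / p = 2 * k := by
  rw [suT, diagonal_mul_natCast_comm_iff]
  refine forall₂_congr fun x y => imp_congr_right fun _ => ?_
  rw [← exp_rat_eq_exp_rat_iff _ (exp_ne_zero (-(Real.pi * I * ((N : ℂ) ^ 2 - 1) / 12)))]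
  push_cast
  simp only [mul_div_assoc]

theorem wTEntry_eq_iff {N p q : ℕ} (a b : Weight N p × Weight N q) :
    wTEntry a = wTEntry b ↔ ∃ k : ℤ,
      dot (fun i => (q : ℤ) * a.1.1 i - p * a.2.1 i) (fun i => (q : ℤ) * a.1.1 i - p * a.2.1 i)
          / (p * q) -
        dot (fun i => (q : ℤ) * b.1.1 i - p * b.2.1 i) (fun i => (q : ℤ) * b.1.1 i - p * b.2.1 i)
          / (p * q) = 2 * k := by
  rw [← exp_rat_eq_exp_rat_iff _ (exp_ne_zero (-(Real.pi * I * ((N : ℂ) - 1) / 12)))]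
  unfold wTEntry
  push_cast
  simp only [mul_div_assoc]

theorem bracket_sq_sum_parity {N : ℕ} (x : Fin N → ℤ) :
    ∃ c : ℤ, ∑ i, bracket x i * bracket x i = ality x + 2 * c := by
  have h : (2 : ℤ) ∣ ∑ i, (bracket x i * bracket x i - bracket x i) :=
    Finset.dvd_sum fun i _ => by
      have := (Int.even_mul_pred_self (bracket x i)).two_dvd
      rwa [mul_sub, mul_one] at this
  obtain ⟨c, hc⟩ := h
  rw [Finset.sum_sub_distrib, sum_bracket] at hc
  exact ⟨c, by linarith⟩

theorem even_pred_mul_sub_of_dvd {N t t' : ℤ} (h : N ∣ t ^ 2 - t' ^ 2) :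
    Even ((N - 1) * (t - t')) := by
  rcases Int.even_or_odd N with hN | hN
  · have h2 : Even (t ^ 2 - t' ^ 2) := even_iff_two_dvd.2 (hN.two_dvd.trans h)
    rw [Int.even_sub, Int.even_pow' two_ne_zero, Int.even_pow' two_ne_zero, ← Int.even_sub] at h2
    exact h2.mul_left _
  · exact (hN.sub_odd odd_one).mul_right _

/-- Integer form of the comparison of the two `T`-conditions: `D` and `t² - t'²` stand for the
differences of `∑ x[i]²` and of `t(x)²`, so that `D - (t² - t'²) / N` is the difference of the
norms. The multiplier `N + 1` is inverted modulo `2p`; when `N` is odd it is only invertible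
modulo `p`, and the factor `2` comes from the parity of `D`. -/
theorem norm_congruence_iff {N p t t' D : ℤ} (hN : N ≠ 0) (hcop : IsCoprime p (N + 1))
    (hD : Even (D - (t - t'))) :
    (∃ k, N * D - (t ^ 2 - t' ^ 2) = 2 * p * N * k) ↔
      ∃ k, (N + 1) * (N * D - (t ^ 2 - t' ^ 2)) - p * N * ((N - 1) * (t - t')) =
        2 * p * N * k := by
  constructor
  · rintro ⟨k, hk⟩
    obtain ⟨c, hc⟩ := even_iff_two_dvd.1 (even_pred_mul_sub_of_dvd (N := N) (t := t) (t' := t')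
      ⟨D - 2 * p * k, by linear_combination -hk⟩)
    exact ⟨(N + 1) * k - c, by rw [hk, hc]; ring⟩
  · rintro ⟨k, hk⟩
    obtain ⟨b, hb⟩ : N ∣ t ^ 2 - t' ^ 2 :=
      ⟨(N + 1) * D - (t ^ 2 - t' ^ 2) - p * ((N - 1) * (t - t')) - 2 * p * k,
        by linear_combination -hk⟩
    -- The term `p (N - 1) (t - t')` is now known to be divisible by `2p`.
    obtain ⟨c, hc⟩ := even_iff_two_dvd.1 (even_pred_mul_sub_of_dvd ⟨b, hb⟩)
    have hm : (N + 1) * (D - b) = 2 * p * (k + c) := by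
      apply mul_left_cancel₀ hN
      rw [hb, hc] at hk
      linear_combination hk
    suffices h : 2 * p ∣ D - b by
      obtain ⟨k', hk'⟩ := h
      exact ⟨k', by rw [hb]; linear_combination N * hk'⟩
    rcases Int.even_or_odd N with hNe | hNo
    · have h2 : IsCoprime (2 : ℤ) (N + 1) := by
        obtain ⟨l, hl⟩ := hNe
        exact ⟨-l, 1, by rw [hl]; ring⟩
      exact (h2.mul_left hcop).dvd_of_dvd_mul_left ⟨k + c, hm⟩
    -- Now `N + 1` is even, so `p` is odd, and `2` and `p` divide `D - b` for separate reasons.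
    · have h2p : IsCoprime (2 : ℤ) p := by
        obtain ⟨l, hl⟩ := hNo
        have h : (2 : ℤ) ∣ N + 1 := ⟨l + 1, by rw [hl]; ring⟩
        exact (hcop.of_isCoprime_of_dvd_right h).symm
      refine h2p.mul_dvd ?_ (hcop.dvd_of_dvd_mul_left ⟨2 * (k + c), by rw [hm]; ring⟩)
      have hb2 : Even b ↔ Even (t - t') := by
        have h3 : Even (t ^ 2 - t' ^ 2) ↔ Even b := by
          rw [hb, Int.even_mul]
          simp [Int.not_even_iff_odd.2 hNo]
        rw [← h3, Int.even_sub, Int.even_pow' two_ne_zero, Int.even_pow' two_ne_zero,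
          ← Int.even_sub]
      rw [← even_iff_two_dvd, Int.even_sub, hb2]
      exact Int.even_sub.1 hD

/-- Two weights have equal `T`-eigenvalues in `SU(N)` at height `p` iff their classes `[x ρ]`,
`[y ρ]` have equal `T`-eigenvalues in `W_N(p, N + 1)`. -/
theorem suT_eq_iff_wTEntry_eq {N p : ℕ} (hN : 0 < N) (hp : 0 < p)
    (hcop : Nat.Coprime p (N + 1)) (x y : Weight N p) :
    (∃ k : ℤ, dot x.1 x.1 / p - dot y.1 y.1 / p = 2 * k) ↔
      wTEntry (x, rho (n := N + 1) hN (Nat.le_succ N)) =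
        wTEntry (y, rho (n := N + 1) hN (Nat.le_succ N)) := by
  have hN' : (N : ℚ) ≠ 0 := by exact_mod_cast hN.ne'
  have hN1 : (N : ℚ) + 1 ≠ 0 := by exact_mod_cast (Nat.succ_ne_zero N)
  have hp' : (p : ℚ) ≠ 0 := by exact_mod_cast hp.ne'
  obtain ⟨a, ha⟩ := bracket_sq_sum_parity x.1
  obtain ⟨a', ha'⟩ := bracket_sq_sum_parity y.1
  obtain ⟨c, hc⟩ := exists_two_mul_dot_rho hN (Nat.le_succ N) x.1
  obtain ⟨c', hc'⟩ := exists_two_mul_dot_rho hN (Nat.le_succ N) y.1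
  have hx := dot_eq x.1 x.1
  have hy := dot_eq y.1 y.1
  rw [ha] at hx
  rw [ha'] at hy
  have key := norm_congruence_iff (N := N) (p := p) (t := ality x.1) (t' := ality y.1)
    (D := ality x.1 + 2 * a - (ality y.1 + 2 * a')) (by exact_mod_cast hN.ne')
    (by exact_mod_cast Nat.isCoprime_iff_coprime.2 hcop) ⟨a - a', by ring⟩
  have h1 : ∀ k : ℤ, dot x.1 x.1 / p - dot y.1 y.1 / p = 2 * k ↔
      (N : ℤ) * (ality x.1 + 2 * a - (ality y.1 + 2 * a')) - (ality x.1 ^ 2 - ality y.1 ^ 2) =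
        2 * p * N * k := by
    intro k
    rw [hx, hy, ← Int.cast_inj (α := ℚ)]
    push_cast
    field_simp
    constructor <;> intro h <;> linear_combination h
  rw [wTEntry_eq_iff, exists_congr h1, key]
  have h2 : ∀ k : ℤ,
      dot (fun i => ((N + 1 : ℕ) : ℤ) * x.1 i - p * (rho hN (Nat.le_succ N)).1 i)
          (fun i => ((N + 1 : ℕ) : ℤ) * x.1 i - p * (rho hN (Nat.le_succ N)).1 i)
          / (p * ((N + 1 : ℕ) : ℚ)) -
        dot (fun i => ((N + 1 : ℕ) : ℤ) * y.1 i - p * (rho hN (Nat.le_succ N)).1 i)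
          (fun i => ((N + 1 : ℕ) : ℤ) * y.1 i - p * (rho hN (Nat.le_succ N)).1 i)
          / (p * ((N + 1 : ℕ) : ℚ)) = 2 * k ↔
      ((N : ℤ) + 1) * ((N : ℤ) * (ality x.1 + 2 * a - (ality y.1 + 2 * a')) -
          (ality x.1 ^ 2 - ality y.1 ^ 2)) - p * N * ((N - 1) * (ality x.1 - ality y.1)) =
        2 * p * N * (k + (c - c')) := by
    intro k
    rw [dot_self_sub, dot_self_sub, hx, hy, ← Int.cast_inj (α := ℚ)]
    push_cast at hc hc' ⊢
    field_simp
    constructor <;> intro h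
    · apply mul_left_cancel₀ hN1
      linear_combination h + N * p * (N + 1) * (hc - hc')
    · linear_combination (N + 1 : ℚ) * h - N * p * (N + 1) * (hc - hc')
  rw [exists_congr h2]
  constructor
  · rintro ⟨k, hk⟩
    exact ⟨k - (c - c'), by rw [hk]; ring⟩
  · rintro ⟨k, hk⟩
    exact ⟨_, hk⟩

/-- Weights with equal `T`-eigenvalues have equal phases `(-1) ^ ((N - 1) t)`. -/
theorem even_pred_mul_ality_sub {N p : ℕ} (hN : 0 < N) (hp : 0 < p) {x y : Weight N p}
    (h : ∃ k : ℤ, dot x.1 x.1 / p - dot y.1 y.1 / p = 2 * k) :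
    Even (((N : ℤ) - 1) * (ality x.1 - ality y.1)) := by
  obtain ⟨k, hk⟩ := h
  have hN' : (N : ℚ) ≠ 0 := by exact_mod_cast hN.ne'
  have hp' : (p : ℚ) ≠ 0 := by exact_mod_cast hp.ne'
  refine even_pred_mul_sub_of_dvd ⟨∑ i, bracket x.1 i * bracket x.1 i -
    ∑ i, bracket y.1 i * bracket y.1 i - 2 * p * k, ?_⟩
  rw [dot_eq, dot_eq] at hk
  rw [← Int.cast_inj (α := ℚ)]
  push_cast at hk ⊢
  field_simp at hk
  simp only [← pow_two]
  linear_combination -hk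

/-! ### The `S`-matrices -/

/-- The sign `(-1) ^ ((N - 1) t(x))`, in the form in which it occurs in the `S`-matrix of
`W_N(p, N + 1)`. -/
noncomputable def vacuumPhase {N : ℕ} (hN : 0 < N) (x : Fin N → ℤ) : ℂ :=
  exp (-(2 * Real.pi * I * (ality x * ality (rho (n := N + 1) hN (Nat.le_succ N)).1) / N))

theorem vacuumPhase_eq_of_even {N : ℕ} (hN : 0 < N) {x y : Fin N → ℤ}
    (h : Even (((N : ℤ) - 1) * (ality x - ality y))) :
    vacuumPhase hN x = vacuumPhase hN y := by
  obtain ⟨c, hc⟩ := h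
  have hN' : (N : ℂ) ≠ 0 := by exact_mod_cast hN.ne'
  have hr : 2 * (ality (rho (n := N + 1) hN (Nat.le_succ N)).1 : ℂ) = N * (N - 1) := by
    exact_mod_cast two_mul_ality_rho hN (Nat.le_succ N)
  have hc' : ((N : ℂ) - 1) * (ality x - ality y) = c + c := by exact_mod_cast hc
  unfold vacuumPhase
  rw [exp_eq_exp_iff_exists_int]
  refine ⟨-c, ?_⟩
  push_cast
  field_simp
  linear_combination (-((ality x : ℂ) - ality y) / 2) * hr - (N / 2 : ℂ) * hc'

theorem wSEntry_rho {N p : ℕ} (hN : 0 < N) (x y : Weight N p) :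
    wSEntry (x, rho (n := N + 1) hN (Nat.le_succ N)) (y, rho hN (Nat.le_succ N)) =
      (1 / ((Real.sqrt (N * ((p : ℝ) * ((N + 1 : ℕ) : ℝ)) ^ (N - 1)) : ℝ) : ℂ) *
        kacPeterson N (((N + 1 : ℕ) : ℚ) / p) (rho (n := N + 1) hN (Nat.le_succ N)).1
          (rho (n := N + 1) hN (Nat.le_succ N)).1) *
        vacuumPhase hN x.1 * vacuumPhase hN y.1 *
        kacPeterson N ((p : ℚ) / ((N + 1 : ℕ) : ℚ)) x.1 y.1 := by
  unfold wSEntry vacuumPhase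
  rw [mul_add, add_div, neg_add, exp_add,
    mul_comm (ality (rho (n := N + 1) hN (Nat.le_succ N)).1 : ℂ) (ality y.1 : ℂ)]
  ring

/-- `exp(2πi (N + 1) / (N p))` and `exp(2πi / (N p))` are both primitive `N p`-th roots of unity, so
the heights `p / (N + 1)` and `p` impose the same commutation relation. -/
theorem kacPeterson_comm_iff {N p : ℕ} (hN : 0 < N) (hp : 0 < p) (hcop : Nat.Coprime p (N + 1))
    (M : Matrix (Weight N p) (Weight N p) ℕ) :
    (Matrix.of fun x y : Weight N p => kacPeterson N ((p : ℚ) / ((N + 1 : ℕ) : ℚ)) x.1 y.1) *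
          M.map (Nat.cast : ℕ → ℂ) =
        M.map (Nat.cast : ℕ → ℂ) *
          (Matrix.of fun x y : Weight N p => kacPeterson N ((p : ℚ) / ((N + 1 : ℕ) : ℚ)) x.1 y.1) ↔
      (Matrix.of fun x y : Weight N p => kacPeterson N (p : ℚ) x.1 y.1) *
          M.map (Nat.cast : ℕ → ℂ) =
        M.map (Nat.cast : ℕ → ℂ) *
          (Matrix.of fun x y : Weight N p => kacPeterson N (p : ℚ) x.1 y.1) := by
  simp only [kacPeterson_eq_kacPetersonAt hN.ne']
  have hNp : N * p ≠ 0 := mul_ne_zero hN.ne' hp.ne'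
  have hN' : (N : ℂ) ≠ 0 := by exact_mod_cast hN.ne'
  have hN1 : (N : ℂ) + 1 ≠ 0 := by exact_mod_cast (Nat.succ_ne_zero N)
  have hp' : (p : ℂ) ≠ 0 := by exact_mod_cast hp.ne'
  have hco : (N + 1).Coprime (N * p) :=
    Nat.Coprime.mul_right (by simp) hcop.symm
  refine kacPetersonAt_comm_iff Weight.val M (Nat.pos_of_ne_zero hNp) ?_ ?_
  · convert isPrimitiveRoot_exp_of_coprime (N + 1) (N * p) hNp hco using 2
    push_cast
    field_simp
  · convert isPrimitiveRoot_exp (N * p) hNp using 2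
    push_cast
    rfl

/-- Under the identification `x ↦ [x ρ]` of the primaries, the two sets of modular data have the
same modular invariants. -/
theorem isModularInvariant_wEntry_iff {N p : ℕ} (hN : 2 ≤ N) (hp : N < p)
    (hcop : Nat.Coprime p (N + 1)) (M : Matrix (Weight N p) (Weight N p) ℕ) (o : Weight N p) :
    IsModularInvariant
        (Matrix.of fun x y : Weight N p =>
          wSEntry (x, rho (n := N + 1) (two_pos.trans_le hN) (Nat.le_succ N))
            (y, rho (two_pos.trans_le hN) (Nat.le_succ N)))
        (Matrix.diagonal fun x : Weight N p =>
          wTEntry (x, rho (n := N + 1) (two_pos.trans_le hN) (Nat.le_succ N))) o M ↔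
      IsModularInvariant (suS N p) (suT N p) o M := by
  have hN0 : 0 < N := by omega
  have hp0 : 0 < p := by omega
  have hT : suT N p * M.map (Nat.cast : ℕ → ℂ) = M.map (Nat.cast : ℕ → ℂ) * suT N p ↔
      (Matrix.diagonal fun x : Weight N p =>
          wTEntry (x, rho (n := N + 1) hN0 (Nat.le_succ N))) * M.map (Nat.cast : ℕ → ℂ) =
        M.map (Nat.cast : ℕ → ℂ) * Matrix.diagonal fun x : Weight N p =>
          wTEntry (x, rho (n := N + 1) hN0 (Nat.le_succ N)) := by
    rw [suT_comm_iff, diagonal_mul_natCast_comm_iff]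
    exact forall₂_congr fun x y => imp_congr_right fun _ =>
      suT_eq_iff_wTEntry_eq hN0 hp0 hcop x y
  unfold IsModularInvariant
  rw [← hT]
  refine and_congr_right fun _ => and_congr_left fun h => ?_
  have hphase : ∀ x y, M x y ≠ 0 → vacuumPhase hN0 x.1 = vacuumPhase hN0 y.1 := fun x y hxy =>
    vacuumPhase_eq_of_even hN0 (even_pred_mul_ality_sub hN0 hp0 (suT_comm_iff M |>.1 h x y hxy))
  have hNR : (0 : ℝ) < N := by exact_mod_cast hN0
  have hpR : (0 : ℝ) < p := by exact_mod_cast hp0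
  have hW : (1 / ((Real.sqrt (N * ((p : ℝ) * ((N + 1 : ℕ) : ℝ)) ^ (N - 1)) : ℝ) : ℂ) *
        kacPeterson N (((N + 1 : ℕ) : ℚ) / p) (rho (n := N + 1) hN0 (Nat.le_succ N)).1
          (rho (n := N + 1) hN0 (Nat.le_succ N)).1) ≠ 0 := by
    refine mul_ne_zero (one_div_ne_zero (ofReal_ne_zero.2 (Real.sqrt_pos.2 (by positivity)).ne'))
      (kacPeterson_rho_ne_zero hN hp0 hcop)
  have hSU : I ^ (N * (N - 1) / 2) / ((Real.sqrt (N * (p : ℝ) ^ (N - 1)) : ℝ) : ℂ) ≠ 0 :=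
    div_ne_zero (pow_ne_zero _ I_ne_zero)
      (ofReal_ne_zero.2 (Real.sqrt_pos.2 (by positivity)).ne')
  rw [twist_mul_natCast_comm_iff (S' := Matrix.of fun x y : Weight N p =>
      wSEntry (x, rho (n := N + 1) hN0 (Nat.le_succ N)) (y, rho hN0 (Nat.le_succ N)))
      (S := Matrix.of fun x y : Weight N p => kacPeterson N ((p : ℚ) / ((N + 1 : ℕ) : ℚ)) x.1 y.1)
      hW
      (fun x : Weight N p => (exp_ne_zero _ : vacuumPhase hN0 x.1 ≠ 0)) hphase
      (fun x y => wSEntry_rho hN0 x y),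
    kacPeterson_comm_iff hN0 hp0 hcop,
    twist_mul_natCast_comm_iff (S' := suS N p) (S := Matrix.of fun x y : Weight N p =>
      kacPeterson N (p : ℚ) x.1 y.1) (e := fun _ => 1) hSU (fun _ => one_ne_zero)
      (fun _ _ _ => rfl) (fun x y => by simp [suS])]

end WNModel

theorem mainTheorem4 (N p : ℕ) (hN : 2 ≤ N) (hp : N < p) (hcop : Nat.Coprime p (N + 1)) :
    Set.BijOn
      (fun (M : Matrix (WNModel.WPrimary N p (N + 1)) (WNModel.WPrimary N p (N + 1)) ℕ) =>
        (Matrix.of fun x y : WNModel.Weight N p =>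
          M (WNModel.wClass x (WNModel.rho (by omega) (Nat.le_succ N)))
            (WNModel.wClass y (WNModel.rho (by omega) (Nat.le_succ N)))))
      {M | WNModel.IsWModularInvariant (by omega) hp.le (Nat.le_succ N) M}
      {M' | WNModel.IsSUModularInvariant (by omega) hp.le M'} := by
  let e : WNModel.Weight N p ≃ WNModel.WPrimary N p (N + 1) :=
    Equiv.ofBijective _ (WNModel.wClass_rho_bijective p hN)
  have hiff : ∀ M, WNModel.IsWModularInvariant (two_pos.trans_le hN) hp.le (Nat.le_succ N) M ↔
      WNModel.IsSUModularInvariant (two_pos.trans_le hN) hp.le (M.submatrix e e) := by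
    intro M
    unfold WNModel.IsSUModularInvariant WNModel.IsWModularInvariant
    rw [← WNModel.isModularInvariant_wEntry_iff hN hp hcop]
    have h := WNModel.isModularInvariant_submatrix e (WNModel.wS N p (N + 1))
      (WNModel.wT N p (N + 1)) (WNModel.rho (two_pos.trans_le hN) hp.le) M
    rw [WNModel.wT, Matrix.submatrix_diagonal_equiv] at h
    exact h.symm
  refine ⟨fun M hM => (hiff M).1 hM, ?_, ?_⟩
  · exact (Matrix.reindex e.symm e.symm).injective.injOn
  · intro M' hM'
    refine ⟨M'.submatrix e.symm e.symm, (hiff _).2 ?_, ?_⟩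
    · simpa using hM'
    · exact (Matrix.reindex e.symm e.symm).apply_symm_apply M'
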